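/- Let $\omega>0$ and let $\gamma_t$, $t\in[0,\omega)$, be a smooth solution of curve shortening flow by closed immersed curves in $\mathbb{R}^3$; that is, $\gamma:[0,\omega)\times(\mathbb{R}/2\pi\mathbb{Z})\to\mathbb{R}^3$, $(t,u)\mapsto\gamma_t(u)$, is smooth, each $\gamma_t$ is an immersion, and $\partial_t\gamma=\kappa N$, where $\kappa$ is the curvature and $N$ the unit normal vector of $\gamma_t$ (with $\kappa N=0$ where $\kappa=0$). Call a curve in $\mathbb{R}^3$ twisted if its first three derivatives are linearly independent at every point; this means that its curvature $\kappa$ and torsion $\tau$ vanish nowhere. Let $t_0\in[0,\omega)$. Suppose that $\gamma_0$ is twisted and that for every $t\in[0,t_0]$ the curve $\gamma_t$ has no inflection point (no point with $\kappa=0$). Then for every $t\in[0,t_0]$ the curve $\gamma_t$ is twisted; in particular, its torsion $\tau$ is nowhere zero. -/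

import Mathlib

noncomputable section

/-- Euclidean three-space. -/
abbrev E3 : Type := EuclideanSpace ℝ (Fin 3)

/-- The cross product of Euclidean three-space. -/
def cross (a b : E3) : E3 := WithLp.toLp 2 (crossProduct a.ofLp b.ofLp)

/-- The derivative `∂ₛ f` of a vector-valued function `f` along the parametrized curve `c` with
respect to arc length: `∂ₛ = |c'|⁻¹ ∂ᵤ`. -/
def arcDeriv (c f : ℝ → E3) (u : ℝ) : E3 := ‖deriv c u‖⁻¹ • deriv f u

/-- The unit tangent vector `T = ∂ₛ c`. -/
def unitTangent (c : ℝ → E3) : ℝ → E3 := arcDeriv c c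

/-- The curvature `κ = |∂ₛ T|`. -/
def curvature (c : ℝ → E3) (u : ℝ) : ℝ := ‖arcDeriv c (unitTangent c) u‖

/-- The unit normal vector `N = κ⁻¹ ∂ₛ T`. Where `κ = 0` this is `0`, so that `κ N = ∂ₛ T` holds
everywhere. -/
def unitNormal (c : ℝ → E3) (u : ℝ) : E3 := (curvature c u)⁻¹ • arcDeriv c (unitTangent c) u

/-- The binormal vector `B = T × N`. -/
def binormal (c : ℝ → E3) (u : ℝ) : E3 := cross (unitTangent c u) (unitNormal c u)

/-- The torsion `τ = ⟨∂ₛ N, B⟩` (meaningful where `κ ≠ 0`). -/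
def torsion (c : ℝ → E3) (u : ℝ) : ℝ := inner ℝ (arcDeriv c (unitNormal c) u) (binormal c u)

/-- The curve `c` has an inflection point: a point of vanishing curvature. -/
def HasInflectionPoint (c : ℝ → E3) : Prop := ∃ u, curvature c u = 0

/-- The curve `c` is twisted: at every point the derivatives `c'`, `c''`, `c'''` are linearly
independent. -/
def IsTwisted (c : ℝ → E3) : Prop :=
  ∀ u, LinearIndependent ℝ (fun k : Fin 3 => iteratedDeriv (k.val + 1) c u)

/-- `γ t u`, `t ∈ [0, ω)`, is a smooth solution of curve shortening flow by closed immersed curves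
`γ t` in three-space, parametrized by the circle `ℝ / 2πℤ`. -/
structure IsCurveShorteningFlow (γ : ℝ → ℝ → E3) (ω : ℝ) : Prop where
  smooth : ContDiffOn ℝ ((⊤ : ℕ∞) : WithTop ℕ∞) (Function.uncurry γ) (Set.Ico 0 ω ×ˢ Set.univ)
  closed : ∀ t ∈ Set.Ico 0 ω, Function.Periodic (γ t) (2 * Real.pi)
  immersed : ∀ t ∈ Set.Ico 0 ω, ∀ u, deriv (γ t) u ≠ 0
  flow : ∀ t ∈ Set.Ico 0 ω, ∀ u,
    HasDerivWithinAt (fun s => γ s u) (curvature (γ t) u • unitNormal (γ t) u) (Set.Ico 0 ω) t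

end

/-!
Let `D = det (γ', γ'', γ''')`, the derivatives being taken with respect to the given parameter `u`.
A curve is twisted exactly when `D` has no zero, and where `κ ≠ 0` the torsion is a positive multiple
of `D` (`torsion_ne_zero`), so it suffices to show that `D` keeps its sign.

In the parameter `u` the flow reads `∂ₜ γ = a γ'' + b γ'` with `a = |γ'|⁻²` and
`b = -⟨γ', γ''⟩ |γ'|⁻⁴` (`arcDeriv_unitTangent`). Differentiating `D` in time and exchanging the
derivatives in `t` and `u` gives `∂ₜ D = a D'' + (3 a' + b) D' + (4 a'' + 6 b') D - 2 a E` with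
`E = det (γ', γ''', γ'''')`. In the absence of inflection points `γ' × γ'' ≠ 0`, and the linear
relation between `γ''`, `γ'''`, `γ''''` in the plane `ℝ³ / ℝγ'` expresses `E` through `D` and `D'`
(`tripleProduct_mul_inner_cross`). Hence `D` solves a linear parabolic equation
`∂ₜ D = a D'' + p D' + q D` (`tripleProduct_variation`) whose coefficient `q` is continuous on
`[0, t₀] × ℝ`, up to the initial time. The maximum principle on the circle (`parabolic_ne_zero`), by
comparison with `ε exp (-K t)`, then shows that `D` does not vanish if it does not vanish at time `0`.

Working with `D` instead of the torsion avoids evolution equations for the curvature and the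
Frenet frame.
-/

open Set Filter Topology
open scoped InnerProductSpace

/-! ### Smooth functions on the slab `[0, ω) × ℝ` -/

theorem uniqueDiffOn_slab (ω : ℝ) : UniqueDiffOn ℝ (Ico 0 ω ×ˢ (univ : Set ℝ)) :=
  (uniqueDiffOn_Ico 0 ω).prod uniqueDiffOn_univ

section Slab

variable {F : Type*} [NormedAddCommGroup F] [NormedSpace ℝ F] {f : ℝ → ℝ → F} {ω t : ℝ}

theorem contDiff_slice (hf : ContDiffOn ℝ ((⊤ : ℕ∞) : WithTop ℕ∞) (Function.uncurry f)
    (Ico 0 ω ×ˢ univ)) (ht : t ∈ Ico 0 ω) : ContDiff ℝ ((⊤ : ℕ∞) : WithTop ℕ∞) (f t) := by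
  rw [← contDiffOn_univ]
  exact hf.comp (f := fun u : ℝ => (t, u)) (contDiffOn_const.prodMk contDiffOn_id)
    fun u _ => ⟨ht, mem_univ u⟩

/-- The derivative along the slices of the slab is smooth up to the boundary time `0`. There it is a
value of `fderivWithin`, since the function need not be differentiable across that time. -/
theorem contDiffOn_uncurry_deriv (hf : ContDiffOn ℝ ((⊤ : ℕ∞) : WithTop ℕ∞) (Function.uncurry f)
    (Ico 0 ω ×ˢ univ)) :
    ContDiffOn ℝ ((⊤ : ℕ∞) : WithTop ℕ∞) (Function.uncurry fun s => deriv (f s))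
      (Ico 0 ω ×ˢ univ) := by
  have h := (hf.fderivWithin (m := ((⊤ : ℕ∞) : WithTop ℕ∞)) (uniqueDiffOn_slab ω)
    (by simp)).clm_apply (contDiffOn_const (c := ((0, 1) : ℝ × ℝ)))
  refine h.congr ?_
  rintro ⟨s, u⟩ ⟨hs, -⟩
  have h1 : HasFDerivWithinAt (Function.uncurry f) _ (Ico 0 ω ×ˢ univ) (s, u) :=
    ((hf.differentiableOn (by simp)) (s, u) ⟨hs, mem_univ _⟩).hasFDerivWithinAt
  have h2 : HasDerivWithinAt (fun v : ℝ => (s, v)) ((0, 1) : ℝ × ℝ) univ u :=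
    ((hasDerivAt_const u s).prodMk (hasDerivAt_id u)).hasDerivWithinAt
  have h3 := h1.comp_hasDerivWithinAt u h2 (fun v _ => ⟨hs, mem_univ _⟩)
  exact (hasDerivWithinAt_univ.1 h3).deriv

theorem contDiffOn_uncurry_iteratedDeriv
    (hf : ContDiffOn ℝ ((⊤ : ℕ∞) : WithTop ℕ∞) (Function.uncurry f) (Ico 0 ω ×ˢ univ)) (k : ℕ) :
    ContDiffOn ℝ ((⊤ : ℕ∞) : WithTop ℕ∞) (Function.uncurry fun s => iteratedDeriv k (f s))
      (Ico 0 ω ×ˢ univ) := by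
  induction k with
  | zero => simpa using hf
  | succ k ih => simpa only [iteratedDeriv_succ] using contDiffOn_uncurry_deriv ih

/-- Symmetry of mixed partial derivatives: if `g` is the time derivative of `f` at time `t`, then
`∂ᵤ g` is the time derivative of `∂ᵤ f`. -/
theorem hasDerivAt_deriv_of_hasDerivAt
    (hf : ContDiffOn ℝ ((⊤ : ℕ∞) : WithTop ℕ∞) (Function.uncurry f) (Ico 0 ω ×ˢ univ))
    (ht : t ∈ Ioo 0 ω) {g : ℝ → F} (hg : ∀ u, HasDerivAt (fun s => f s u) (g u) t) (u : ℝ) :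
    HasDerivAt (fun s => deriv (f s) u) (deriv g u) t := by
  have hO : IsOpen (Ioo 0 ω ×ˢ (univ : Set ℝ)) := isOpen_Ioo.prod isOpen_univ
  have hfO := hf.mono (prod_mono_left (t := (univ : Set ℝ)) Ioo_subset_Ico_self)
  have hd : ∀ s ∈ Ioo 0 ω, ∀ v, ContDiffAt ℝ ((⊤ : ℕ∞) : WithTop ℕ∞) (Function.uncurry f) (s, v) :=
    fun s hs v => hfO.contDiffAt (hO.mem_nhds ⟨hs, mem_univ _⟩)
  have hline₁ : ∀ s v : ℝ, HasDerivAt (fun r : ℝ => ((r, v) : ℝ × ℝ)) (1, 0) s := fun s v =>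
    (hasDerivAt_id s).prodMk (hasDerivAt_const s v)
  have hline₂ : ∀ s v : ℝ, HasDerivAt (fun r : ℝ => ((s, r) : ℝ × ℝ)) (0, 1) v := fun s v =>
    (hasDerivAt_const v s).prodMk (hasDerivAt_id v)
  have hd' : ∀ s ∈ Ioo 0 ω, ∀ v, HasFDerivAt (Function.uncurry f)
      (fderiv ℝ (Function.uncurry f) (s, v)) (s, v) := fun s hs v =>
    ((hd s hs v).differentiableAt (by simp)).hasFDerivAt
  have hu : ∀ s ∈ Ioo 0 ω, ∀ v,
      deriv (f s) v = fderiv ℝ (Function.uncurry f) (s, v) (0, 1) := fun s hs v => by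
    have h : HasDerivAt (f s) _ v := (hd' s hs v).comp_hasDerivAt v (hline₂ s v)
    exact h.deriv
  have hgt : ∀ v, g v = fderiv ℝ (Function.uncurry f) (t, v) (1, 0) := fun v => by
    have h : HasDerivAt (Function.uncurry f ∘ fun r => (r, v)) _ t :=
      (hd' t ht v).comp_hasDerivAt t (hline₁ t v)
    exact (hg v).unique h
  have h2 : HasFDerivAt (fderiv ℝ (Function.uncurry f))
      (fderiv ℝ (fderiv ℝ (Function.uncurry f)) (t, u)) (t, u) :=
    (((hd t ht u).fderiv_right (m := 1) (by norm_cast)).differentiableAt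
      one_ne_zero).hasFDerivAt
  have hsymm := (hd t ht u).isSymmSndFDerivAt (by simp; norm_cast)
  have h3 : HasDerivAt (fun v => fderiv ℝ (Function.uncurry f) (t, v)) _ u :=
    h2.comp_hasDerivAt u (hline₂ t u)
  have h4 : HasDerivAt (fun s => fderiv ℝ (Function.uncurry f) (s, u)) _ t :=
    h2.comp_hasDerivAt t (hline₁ t u)
  have h3' := h3.clm_apply (hasDerivAt_const u ((1, 0) : ℝ × ℝ))
  have h4' := h4.clm_apply (hasDerivAt_const t ((0, 1) : ℝ × ℝ))
  rw [map_zero, add_zero] at h3' h4'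
  have h5 : deriv g u = fderiv ℝ (fderiv ℝ (Function.uncurry f)) (t, u) (0, 1) (1, 0) := by
    rw [funext hgt]
    exact h3'.deriv
  rw [h5, hsymm.eq]
  refine h4'.congr_of_eventuallyEq ?_
  filter_upwards [isOpen_Ioo.mem_nhds ht] with s hs using hu s hs u

theorem hasDerivAt_iteratedDeriv_of_hasDerivAt
    (hf : ContDiffOn ℝ ((⊤ : ℕ∞) : WithTop ℕ∞) (Function.uncurry f) (Ico 0 ω ×ˢ univ))
    (ht : t ∈ Ioo 0 ω) {g : ℝ → F} (hg : ∀ u, HasDerivAt (fun s => f s u) (g u) t) (k : ℕ) (u : ℝ) :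
    HasDerivAt (fun s => iteratedDeriv k (f s) u) (iteratedDeriv k g u) t := by
  induction k generalizing u with
  | zero => simpa using hg u
  | succ k ih =>
    simpa only [iteratedDeriv_succ] using
      hasDerivAt_deriv_of_hasDerivAt (contDiffOn_uncurry_iteratedDeriv hf k) ht ih u

end Slab

/-! ### A maximum principle on the circle -/

theorem IsLocalMin.deriv_deriv_nonneg {f : ℝ → ℝ} {x : ℝ} (h : IsLocalMin f x)
    (hc : ContinuousAt f x) : 0 ≤ deriv (deriv f) x := by
  by_contra! hneg
  -- a negative second derivative makes `x` a local maximum too, so `f` is constant near `x`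
  have hmax := isLocalMax_of_deriv_deriv_neg hneg h.deriv_eq_zero hc
  have hconst : f =ᶠ[𝓝 x] fun _ => f x := by
    filter_upwards [h, hmax] with y h1 h2 using le_antisymm h2 h1
  have := hconst.deriv.deriv_eq
  simp at this
  exact hneg.ne this

/-- Weak maximum principle for the linear equation `∂ₜ D = a ∂ᵤ² D + p ∂ᵤ D + q D` on a circle,
with `a ≥ 0`: positive initial values stay positive. Only the zeroth-order coefficient has to be
controlled. -/
theorem parabolic_pos {D a p q : ℝ → ℝ → ℝ} {t₀ P : ℝ} (hP : 0 < P)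
    (hD : ContinuousOn (Function.uncurry D) (Icc 0 t₀ ×ˢ univ))
    (hq : ContinuousOn (Function.uncurry q) (Icc 0 t₀ ×ˢ univ))
    (hper : ∀ t ∈ Icc 0 t₀, Function.Periodic (D t) P)
    (ha : ∀ t ∈ Ioc 0 t₀, ∀ u, 0 ≤ a t u)
    (heq : ∀ t ∈ Ioc 0 t₀, ∀ u, HasDerivAt (fun s => D s u)
      (a t u * deriv (deriv (D t)) u + p t u * deriv (D t) u + q t u * D t u) t)
    (h0 : ∀ u, 0 < D 0 u) : ∀ t ∈ Icc 0 t₀, ∀ u, 0 < D t u := by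
  intro t ht u
  have ht₀ : 0 ≤ t₀ := ht.1.trans ht.2
  have hslice : ∀ s ∈ Icc 0 t₀, Continuous (D s) := fun s hs => by
    rw [← continuousOn_univ]
    exact hD.comp (f := fun u : ℝ => (s, u)) (by fun_prop) fun u _ => ⟨hs, mem_univ u⟩
  obtain ⟨K, hK⟩ : ∃ K, ∀ s ∈ Icc 0 t₀, ∀ v ∈ Icc 0 P, -K < q s v := by
    obtain ⟨C, hC⟩ := (isCompact_Icc.prod (isCompact_Icc (a := (0 : ℝ)) (b := P))).bddBelow_image
      (hq.mono (prod_mono_right (subset_univ _)))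
    refine ⟨1 - C, fun s hs v hv => ?_⟩
    have : C ≤ q s v := hC ⟨(s, v), ⟨hs, hv⟩, rfl⟩
    linarith
  obtain ⟨ε, hε, hε0⟩ : ∃ ε > 0, ∀ v ∈ Icc 0 P, ε < D 0 v := by
    obtain ⟨v, hv, hmin⟩ := isCompact_Icc.exists_isMinOn (nonempty_Icc.2 hP.le)
      (hslice 0 ⟨le_rfl, ht₀⟩).continuousOn
    exact ⟨D 0 v / 2, half_pos (h0 v), fun w hw => (half_lt_self (h0 v)).trans_le (hmin hw)⟩
  -- since `-K < q`, the barrier `ε * exp (-K t)` is a strict subsolution, so `D` stays above it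
  suffices H : ∀ s ∈ Icc 0 t₀, ∀ v ∈ Icc 0 P, ε * Real.exp (-K * s) < D s v by
    obtain ⟨v, hv, hvu⟩ := (hper t ht).exists_mem_Ico₀ hP u
    rw [hvu]
    exact (by positivity : (0 : ℝ) < ε * Real.exp (-K * t)).trans (H t ht v (Ico_subset_Icc_self hv))
  by_contra! hne
  obtain ⟨s₁, hs₁, v₁, hv₁, hle₁⟩ := hne
  -- the first time `s` at which the barrier is reached, at the point `v`
  let A : Set (ℝ × ℝ) := {x ∈ Icc 0 t₀ ×ˢ Icc 0 P | D x.1 x.2 - ε * Real.exp (-K * x.1) ≤ 0}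
  have hA : IsCompact A := by
    have hcont : ContinuousOn (fun x : ℝ × ℝ => D x.1 x.2 - ε * Real.exp (-K * x.1))
        (Icc 0 t₀ ×ˢ Icc 0 P) :=
      (hD.mono (prod_mono_right (subset_univ _))).sub (by fun_prop)
    exact (isCompact_Icc.prod isCompact_Icc).of_isClosed_subset
      (hcont.preimage_isClosed_of_isClosed (isClosed_Icc.prod isClosed_Icc) isClosed_Iic)
      (fun x hx => hx.1)
  obtain ⟨⟨s, v⟩, ⟨⟨hs, hv⟩, hle⟩, hfirst⟩ :=
    hA.exists_isMinOn ⟨(s₁, v₁), ⟨hs₁, hv₁⟩, by simpa using hle₁⟩ continuous_fst.continuousOn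
  simp only at hs hv hle
  have hbefore : ∀ r ∈ Ico 0 s, ∀ w, ε * Real.exp (-K * r) < D r w := by
    intro r hr w
    have hr' : r ∈ Icc 0 t₀ := ⟨hr.1, hr.2.le.trans hs.2⟩
    obtain ⟨w', hw', hww'⟩ := (hper r hr').exists_mem_Ico₀ hP w
    rw [hww']
    by_contra! hcon
    exact absurd (hfirst (show (r, w') ∈ A from
      ⟨⟨hr', Ico_subset_Icc_self hw'⟩, by simpa using hcon⟩)) (not_le.2 hr.2)
  have hspos : 0 < s := by
    refine hs.1.lt_of_ne fun h => ?_
    have := hε0 v hv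
    rw [← h] at hle
    simp at hle
    linarith
  have hat : ∀ w, ε * Real.exp (-K * s) ≤ D s w := by
    intro w
    have hev : ∀ᶠ r in 𝓝[<] s, ε * Real.exp (-K * r) ≤ D r w := by
      filter_upwards [Ico_mem_nhdsLT hspos] with r hr using (hbefore r hr w).le
    refine le_of_tendsto_of_tendsto
      (((by fun_prop : Continuous fun r : ℝ => ε * Real.exp (-K * r)).tendsto s).mono_left
        nhdsWithin_le_nhds) ?_ hev
    exact (heq s ⟨hspos, hs.2⟩ w).continuousAt.tendsto.mono_left nhdsWithin_le_nhds
  have hDs : D s v = ε * Real.exp (-K * s) := le_antisymm (by linarith) (hat v)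
  have hlocmin : IsLocalMin (D s) v := Eventually.of_forall fun w => by rw [hDs]; exact hat w
  have h1 := hlocmin.deriv_eq_zero
  have h2 := hlocmin.deriv_deriv_nonneg (hslice s hs).continuousAt
  have hder := heq s ⟨hspos, hs.2⟩ v
  rw [h1, hDs] at hder
  have hexp : HasDerivAt (fun r => ε * Real.exp (-K * r)) (ε * (Real.exp (-K * s) * (-K * 1))) s :=
    (((hasDerivAt_id s).const_mul (-K)).exp).const_mul ε
  have hdiff := hder.sub hexp
  -- the difference of `D` and the barrier is positive before time `s` and vanishes at `s`
  have hnonpos : a s v * deriv (deriv (D s)) v + p s v * 0 + q s v * (ε * Real.exp (-K * s))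
      - ε * (Real.exp (-K * s) * (-K * 1)) ≤ 0 := by
    refine le_of_tendsto (hasDerivAt_iff_tendsto_slope_left_right.1 hdiff).1 ?_
    filter_upwards [Ico_mem_nhdsLT hspos] with r hr
    rw [slope_def_field]
    refine div_nonpos_of_nonneg_of_nonpos ?_ (by linarith [hr.2])
    have := hbefore r hr v
    simp only [Pi.sub_apply, hDs]
    linarith
  have hpos : 0 < (q s v + K) * (ε * Real.exp (-K * s)) :=
    mul_pos (by linarith [hK s hs v hv]) (by positivity)
  nlinarith [mul_nonneg (ha s ⟨hspos, hs.2⟩ v) h2]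

theorem parabolic_ne_zero {D a p q : ℝ → ℝ → ℝ} {t₀ P : ℝ} (hP : 0 < P)
    (hD : ContinuousOn (Function.uncurry D) (Icc 0 t₀ ×ˢ univ))
    (hq : ContinuousOn (Function.uncurry q) (Icc 0 t₀ ×ˢ univ))
    (hper : ∀ t ∈ Icc 0 t₀, Function.Periodic (D t) P)
    (ha : ∀ t ∈ Ioc 0 t₀, ∀ u, 0 ≤ a t u)
    (heq : ∀ t ∈ Ioc 0 t₀, ∀ u, HasDerivAt (fun s => D s u)
      (a t u * deriv (deriv (D t)) u + p t u * deriv (D t) u + q t u * D t u) t)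
    (h0 : ∀ u, D 0 u ≠ 0) : ∀ t ∈ Icc 0 t₀, ∀ u, D t u ≠ 0 := by
  intro t ht u
  have hc : Continuous (D 0) := by
    rw [← continuousOn_univ]
    exact hD.comp (f := fun u : ℝ => ((0 : ℝ), u)) (by fun_prop)
      fun u _ => ⟨⟨le_rfl, ht.1.trans ht.2⟩, mem_univ u⟩
  have hsign : (∀ v, 0 < D 0 v) ∨ ∀ v, 0 < -D 0 v := by
    by_contra! hcon
    obtain ⟨⟨v, hv⟩, w, hw⟩ := hcon
    obtain ⟨x, hx⟩ := mem_range_of_exists_le_of_exists_ge hc ⟨v, hv⟩ ⟨w, by linarith⟩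
    exact h0 x hx
  rcases hsign with h | h
  · exact (parabolic_pos hP hD hq hper ha heq h t ht u).ne'
  · refine fun hz => (parabolic_pos (D := fun s v => -D s v) (p := p) hP hD.neg hq
      (fun s hs v => by simp [hper s hs v]) ha (fun s hs v => ?_) h t ht u).ne' (by simp [hz])
    refine (heq s hs v).neg.congr_deriv ?_
    have h1 : deriv (fun v => -D s v) = fun v => -deriv (D s) v := funext fun v => deriv.fun_neg
    rw [h1, deriv.fun_neg]
    ring

/-! ### Triple products -/

theorem inner_eq_sum_coords (x y : E3) : ⟪x, y⟫_ℝ = x 0 * y 0 + x 1 * y 1 + x 2 * y 2 := by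
  simp [PiLp.inner_apply, Fin.sum_univ_three]
  ring

/-- The triple product `⟨x, y × z⟩`, that is, the determinant of the three vectors. -/
noncomputable def tripleProduct (x y z : E3) : ℝ := ⟪x, cross y z⟫_ℝ

theorem tripleProduct_eq_coords (x y z : E3) : tripleProduct x y z =
    x 0 * (y 1 * z 2 - y 2 * z 1) + x 1 * (y 2 * z 0 - y 0 * z 2) +
      x 2 * (y 0 * z 1 - y 1 * z 0) := by
  simp [tripleProduct, inner_eq_sum_coords, cross, cross_apply]

theorem linearIndependent_iff_tripleProduct_ne_zero (v : Fin 3 → E3) :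
    LinearIndependent ℝ v ↔ tripleProduct (v 0) (v 1) (v 2) ≠ 0 := by
  have h : LinearIndependent ℝ v ↔ LinearIndependent ℝ (Matrix.of fun i => (v i).ofLp).row :=
    (LinearMap.linearIndependent_iff (WithLp.linearEquiv 2 ℝ (Fin 3 → ℝ)).toLinearMap
      (LinearEquiv.ker _)).symm
  rw [h, Matrix.linearIndependent_rows_iff_isUnit, Matrix.isUnit_iff_isUnit_det, isUnit_iff_ne_zero,
    Matrix.det_fin_three, tripleProduct_eq_coords]
  simp only [Matrix.of_apply]
  ring_nf

theorem HasDerivAt.coord {x : ℝ → E3} {x' : E3} {t : ℝ} (h : HasDerivAt x x' t) (i : Fin 3) :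
    HasDerivAt (fun s => x s i) (x' i) t :=
  (EuclideanSpace.proj (𝕜 := ℝ) i).hasFDerivAt.comp_hasDerivAt t h

theorem HasDerivAt.tripleProduct {x y z : ℝ → E3} {x' y' z' : E3} {t : ℝ}
    (hx : HasDerivAt x x' t) (hy : HasDerivAt y y' t) (hz : HasDerivAt z z' t) :
    HasDerivAt (fun s => tripleProduct (x s) (y s) (z s))
      (tripleProduct x' (y t) (z t) + tripleProduct (x t) y' (z t) +
        tripleProduct (x t) (y t) z') t := by
  simp only [tripleProduct_eq_coords]
  have := (((hx.coord 0).mul (((hy.coord 1).mul (hz.coord 2)).sub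
    ((hy.coord 2).mul (hz.coord 1)))).add ((hx.coord 1).mul
    (((hy.coord 2).mul (hz.coord 0)).sub ((hy.coord 0).mul (hz.coord 2))))).add
    ((hx.coord 2).mul (((hy.coord 0).mul (hz.coord 1)).sub ((hy.coord 1).mul (hz.coord 0))))
  refine this.congr_deriv ?_
  simp only [Pi.mul_apply, Pi.sub_apply]
  ring

/-- Lagrange's identity. -/
theorem inner_cross_cross (a b c d : E3) :
    ⟪cross a b, cross c d⟫_ℝ = ⟪a, c⟫_ℝ * ⟪b, d⟫_ℝ - ⟪a, d⟫_ℝ * ⟪b, c⟫_ℝ := by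
  simp only [inner_eq_sum_coords, cross, cross_apply]
  simp
  ring

/-- In the plane `ℝ³ / ℝx` the three vectors `y`, `z`, `w` satisfy the linear relation
`[z,w] y - [y,w] z + [y,z] w = 0`, where `[·,·]` is the triple product with `x`. This is that
relation crossed with `x` and paired with `x × y`. -/
theorem tripleProduct_mul_inner_cross (x y z w : E3) :
    tripleProduct x z w * ⟪cross x y, cross x y⟫_ℝ =
      tripleProduct x y w * ⟪cross x y, cross x z⟫_ℝ -
        tripleProduct x y z * ⟪cross x y, cross x w⟫_ℝ := by
  simp only [tripleProduct_eq_coords, inner_eq_sum_coords, cross, cross_apply]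
  simp
  ring

/-! ### Curvature and torsion in an arbitrary parametrization -/

/-- The coefficient `a = |c'|⁻²` of `c''` in the curvature vector `∂ₛ² c = a c'' + b c'`. -/
noncomputable def secondOrderCoeff (c : ℝ → E3) (u : ℝ) : ℝ :=
  (⟪iteratedDeriv 1 c u, iteratedDeriv 1 c u⟫_ℝ)⁻¹

/-- The coefficient `b = -⟨c', c''⟩ |c'|⁻⁴` of `c'` in the curvature vector
`∂ₛ² c = a c'' + b c'`. -/
noncomputable def firstOrderCoeff (c : ℝ → E3) (u : ℝ) : ℝ :=
  -⟪iteratedDeriv 1 c u, iteratedDeriv 2 c u⟫_ℝ *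
    (⟪iteratedDeriv 1 c u, iteratedDeriv 1 c u⟫_ℝ)⁻¹ ^ 2

section Curve

variable {c : ℝ → E3} {u : ℝ}

theorem hasDerivAt_iteratedDeriv {F : Type*} [NormedAddCommGroup F] [NormedSpace ℝ F] {f : ℝ → F}
    (hf : ContDiff ℝ ((⊤ : ℕ∞) : WithTop ℕ∞) f) (k : ℕ) (u : ℝ) :
    HasDerivAt (iteratedDeriv k f) (iteratedDeriv (k + 1) f u) u := by
  rw [iteratedDeriv_succ]
  exact (hf.differentiable_iteratedDeriv k (by exact_mod_cast WithTop.coe_lt_top k) u).hasDerivAt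

theorem curvature_smul_unitNormal (c : ℝ → E3) (u : ℝ) :
    curvature c u • unitNormal c u = arcDeriv c (unitTangent c) u := by
  rw [unitNormal, smul_smul]
  by_cases h : curvature c u = 0
  · have : arcDeriv c (unitTangent c) u = 0 := norm_eq_zero.1 h
    simp [this]
  · rw [mul_inv_cancel₀ h, one_smul]

theorem hasDerivAt_inv_norm {x : ℝ → E3} {x' : E3} (hx : HasDerivAt x x' u) (h0 : x u ≠ 0) :
    HasDerivAt (fun v => ‖x v‖⁻¹) (-⟪x u, x'⟫_ℝ * ‖x u‖⁻¹ ^ 3) u := by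
  have hn : ‖x u‖ ≠ 0 := norm_ne_zero_iff.2 h0
  have h1 := (hx.norm_sq.sqrt (by positivity)).inv (by positivity)
  simp only [Real.sqrt_sq (norm_nonneg _)] at h1
  refine h1.congr_deriv ?_
  field_simp

theorem arcDeriv_unitTangent (hc : ContDiff ℝ ((⊤ : ℕ∞) : WithTop ℕ∞) c) (h0 : deriv c u ≠ 0) :
    arcDeriv c (unitTangent c) u = secondOrderCoeff c u • iteratedDeriv 2 c u +
      firstOrderCoeff c u • iteratedDeriv 1 c u := by
  have h1 : HasDerivAt (deriv c) (iteratedDeriv 2 c u) u := by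
    simpa only [iteratedDeriv_one] using hasDerivAt_iteratedDeriv hc 1 u
  have h2 : HasDerivAt (unitTangent c) _ u := (hasDerivAt_inv_norm h1 h0).smul h1
  have hn : ‖deriv c u‖ ≠ 0 := norm_ne_zero_iff.2 h0
  rw [arcDeriv, h2.deriv, secondOrderCoeff, firstOrderCoeff, iteratedDeriv_one,
    real_inner_self_eq_norm_sq, smul_add, smul_smul, smul_smul]
  congr 2
  · field_simp
  · field_simp

/-- By Lagrange's identity `κ² |c'|⁶ = |c' × c''|²`. -/
theorem inner_cross_self_ne_zero (hc : ContDiff ℝ ((⊤ : ℕ∞) : WithTop ℕ∞) c) (h0 : deriv c u ≠ 0)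
    (hκ : curvature c u ≠ 0) :
    ⟪cross (iteratedDeriv 1 c u) (iteratedDeriv 2 c u),
      cross (iteratedDeriv 1 c u) (iteratedDeriv 2 c u)⟫_ℝ ≠ 0 := by
  intro hz
  refine hκ ?_
  rw [inner_cross_cross] at hz
  rw [← iteratedDeriv_one] at h0
  have hX : ⟪iteratedDeriv 1 c u, iteratedDeriv 1 c u⟫_ℝ ≠ 0 := inner_self_ne_zero.2 h0
  rw [curvature, arcDeriv_unitTangent hc (by rwa [← iteratedDeriv_one]), norm_eq_zero,
    ← inner_self_eq_zero (𝕜 := ℝ)]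
  simp only [inner_add_left, inner_add_right, real_inner_smul_left, real_inner_smul_right,
    secondOrderCoeff, firstOrderCoeff]
  rw [real_inner_comm (iteratedDeriv 1 c u) (iteratedDeriv 2 c u)] at hz ⊢
  field_simp
  linear_combination hz

/-- With `κ N = a c'' + b c'` the torsion is `τ = |c'|⁻² (a / κ)² det (c', c'', c''')`: in
`N = κ⁻¹ (a c'' + b c')` and `∂ₛ N` the terms along `c'` and `c''` do not contribute. -/
theorem torsion_ne_zero (hc : ContDiff ℝ ((⊤ : ℕ∞) : WithTop ℕ∞) c) (him : ∀ u, deriv c u ≠ 0)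
    (hκ : curvature c u ≠ 0)
    (ht : tripleProduct (iteratedDeriv 1 c u) (iteratedDeriv 2 c u) (iteratedDeriv 3 c u) ≠ 0) :
    torsion c u ≠ 0 := by
  have hX := hasDerivAt_iteratedDeriv hc 1 u
  have hY := hasDerivAt_iteratedDeriv hc 2 u
  have hX0 : ⟪iteratedDeriv 1 c u, iteratedDeriv 1 c u⟫_ℝ ≠ 0 :=
    inner_self_ne_zero.2 (by rw [iteratedDeriv_one]; exact him u)
  have ha : DifferentiableAt ℝ (secondOrderCoeff c) u :=
    (hX.differentiableAt.inner ℝ hX.differentiableAt).inv hX0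
  have hb : DifferentiableAt ℝ (firstOrderCoeff c) u :=
    (hX.differentiableAt.inner ℝ hY.differentiableAt).neg.mul (ha.pow 2)
  have hA := (ha.hasDerivAt.smul hY).add (hb.hasDerivAt.smul hX)
  rw [show secondOrderCoeff c • iteratedDeriv 2 c + firstOrderCoeff c • iteratedDeriv 1 c =
    arcDeriv c (unitTangent c) from funext fun v => (arcDeriv_unitTangent hc (him v)).symm] at hA
  have hκd : DifferentiableAt ℝ (fun v => (curvature c v)⁻¹) u :=
    (hA.differentiableAt.norm ℝ (norm_ne_zero_iff.1 hκ)).inv hκ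
  have hN : HasDerivAt (unitNormal c) _ u := hκd.hasDerivAt.smul hA
  have ha0 : secondOrderCoeff c u ≠ 0 := inv_ne_zero hX0
  have hv0 : ‖deriv c u‖⁻¹ ≠ 0 := inv_ne_zero (norm_ne_zero_iff.2 (him u))
  have key : torsion c u = ‖deriv c u‖⁻¹ ^ 2 * (curvature c u)⁻¹ ^ 2 * secondOrderCoeff c u ^ 2 *
      tripleProduct (iteratedDeriv 1 c u) (iteratedDeriv 2 c u) (iteratedDeriv 3 c u) := by
    rw [torsion, binormal, arcDeriv, hN.deriv, unitNormal, arcDeriv_unitTangent hc (him u),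
      unitTangent, arcDeriv, ← iteratedDeriv_one]
    simp only [tripleProduct_eq_coords, inner_eq_sum_coords, cross, cross_apply]
    simp
    ring
  rw [key]
  exact mul_ne_zero (mul_ne_zero (mul_ne_zero (pow_ne_zero _ hv0) (pow_ne_zero _ (inv_ne_zero hκ)))
    (pow_ne_zero _ ha0)) ht

/-- The variation of `det (c', c'', c''')` when `c` moves with velocity `w = a c'' + b c'`.
The only term that is not visibly a combination of `D`, `D'` and `D''` is
`-2 a det (c', c''', c'''')`; `tripleProduct_mul_inner_cross` reduces it to `D` and `D'`, at the cost
of dividing by `|c' × c''|²`. -/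
theorem tripleProduct_variation {a b : ℝ → ℝ} (hc : ContDiff ℝ ((⊤ : ℕ∞) : WithTop ℕ∞) c)
    (ha : ContDiff ℝ ((⊤ : ℕ∞) : WithTop ℕ∞) a) (hb : ContDiff ℝ ((⊤ : ℕ∞) : WithTop ℕ∞) b)
    {w : ℝ → E3} {D : ℝ → ℝ} (hw : w = fun v => a v • iteratedDeriv 2 c v + b v • iteratedDeriv 1 c v)
    (hD : D = fun v => tripleProduct (iteratedDeriv 1 c v) (iteratedDeriv 2 c v)
      (iteratedDeriv 3 c v))
    (hn : ⟪cross (iteratedDeriv 1 c u) (iteratedDeriv 2 c u),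
      cross (iteratedDeriv 1 c u) (iteratedDeriv 2 c u)⟫_ℝ ≠ 0) :
    tripleProduct (iteratedDeriv 1 w u) (iteratedDeriv 2 c u) (iteratedDeriv 3 c u) +
    tripleProduct (iteratedDeriv 1 c u) (iteratedDeriv 2 w u) (iteratedDeriv 3 c u) +
    tripleProduct (iteratedDeriv 1 c u) (iteratedDeriv 2 c u) (iteratedDeriv 3 w u) =
    a u * deriv (deriv D) u +
    (3 * iteratedDeriv 1 a u + b u -
      2 * a u * ⟪cross (iteratedDeriv 1 c u) (iteratedDeriv 2 c u),
        cross (iteratedDeriv 1 c u) (iteratedDeriv 3 c u)⟫_ℝ *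
      (⟪cross (iteratedDeriv 1 c u) (iteratedDeriv 2 c u),
        cross (iteratedDeriv 1 c u) (iteratedDeriv 2 c u)⟫_ℝ)⁻¹) * deriv D u +
    (4 * iteratedDeriv 2 a u + 6 * iteratedDeriv 1 b u +
      2 * a u * ⟪cross (iteratedDeriv 1 c u) (iteratedDeriv 2 c u),
        cross (iteratedDeriv 1 c u) (iteratedDeriv 4 c u)⟫_ℝ *
      (⟪cross (iteratedDeriv 1 c u) (iteratedDeriv 2 c u),
        cross (iteratedDeriv 1 c u) (iteratedDeriv 2 c u)⟫_ℝ)⁻¹) * D u := by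
  have hX := hasDerivAt_iteratedDeriv hc
  have hA := hasDerivAt_iteratedDeriv ha
  have hB := hasDerivAt_iteratedDeriv hb
  have hw1 : ∀ v, HasDerivAt w (a v • iteratedDeriv 3 c v +
      (iteratedDeriv 1 a v + b v) • iteratedDeriv 2 c v +
      iteratedDeriv 1 b v • iteratedDeriv 1 c v) v := fun v => by
    rw [hw]
    have hA0 := hA 0 v
    have hB0 := hB 0 v
    rw [iteratedDeriv_zero] at hA0 hB0
    refine HasDerivAt.congr_deriv ((hA0.smul (hX 2 v)).add (hB0.smul (hX 1 v))) ?_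
    module
  have hw2 : ∀ v, HasDerivAt (iteratedDeriv 1 w) (a v • iteratedDeriv 4 c v +
      (2 * iteratedDeriv 1 a v + b v) • iteratedDeriv 3 c v +
      (iteratedDeriv 2 a v + 2 * iteratedDeriv 1 b v) • iteratedDeriv 2 c v +
      iteratedDeriv 2 b v • iteratedDeriv 1 c v) v := fun v => by
    rw [iteratedDeriv_one, funext fun v => (hw1 v).deriv]
    have hA0 := hA 0 v
    have hB0 := hB 0 v
    rw [iteratedDeriv_zero] at hA0 hB0
    refine HasDerivAt.congr_deriv (((hA0.smul (hX 3 v)).add (((hA 1 v).add hB0).smul (hX 2 v))).add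
      ((hB 1 v).smul (hX 1 v))) ?_
    simp only [Pi.add_apply]
    module
  have hw3 : ∀ v, HasDerivAt (iteratedDeriv 2 w) (a v • iteratedDeriv 5 c v +
      (3 * iteratedDeriv 1 a v + b v) • iteratedDeriv 4 c v +
      (3 * iteratedDeriv 2 a v + 3 * iteratedDeriv 1 b v) • iteratedDeriv 3 c v +
      (iteratedDeriv 3 a v + 3 * iteratedDeriv 2 b v) • iteratedDeriv 2 c v +
      iteratedDeriv 3 b v • iteratedDeriv 1 c v) v := fun v => by
    rw [iteratedDeriv_succ, funext fun v => (hw2 v).deriv]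
    have hA0 := hA 0 v
    have hB0 := hB 0 v
    rw [iteratedDeriv_zero] at hA0 hB0
    refine HasDerivAt.congr_deriv ((((hA0.smul (hX 4 v)).add ((((hA 1 v).const_mul 2).add hB0).smul (hX 3 v))).add
      (((hA 2 v).add ((hB 1 v).const_mul 2)).smul (hX 2 v))).add
      ((hB 2 v).smul (hX 1 v))) ?_
    simp only [Pi.add_apply]
    module
  have hD1 : deriv D = fun v => tripleProduct (iteratedDeriv 1 c v) (iteratedDeriv 2 c v)
      (iteratedDeriv 4 c v) := funext fun v => by
    rw [hD, ((hX 1 v).tripleProduct (hX 2 v) (hX 3 v)).deriv]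
    simp only [tripleProduct_eq_coords]
    ring
  have hD2 : deriv (deriv D) u = tripleProduct (iteratedDeriv 1 c u) (iteratedDeriv 3 c u)
      (iteratedDeriv 4 c u) + tripleProduct (iteratedDeriv 1 c u) (iteratedDeriv 2 c u)
      (iteratedDeriv 5 c u) := by
    rw [hD1, ((hX 1 u).tripleProduct (hX 2 u) (hX 4 u)).deriv]
    simp only [tripleProduct_eq_coords]
    ring
  rw [hD2, hD1, hD, iteratedDeriv_one (f := w), (hw1 u).deriv, iteratedDeriv_succ (n := 1) (f := w),
    (hw2 u).deriv, iteratedDeriv_succ (n := 2) (f := w), (hw3 u).deriv]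
  have hrel : tripleProduct (iteratedDeriv 1 c u) (iteratedDeriv 3 c u) (iteratedDeriv 4 c u) =
      (tripleProduct (iteratedDeriv 1 c u) (iteratedDeriv 2 c u) (iteratedDeriv 4 c u) *
      ⟪cross (iteratedDeriv 1 c u) (iteratedDeriv 2 c u),
        cross (iteratedDeriv 1 c u) (iteratedDeriv 3 c u)⟫_ℝ -
      tripleProduct (iteratedDeriv 1 c u) (iteratedDeriv 2 c u) (iteratedDeriv 3 c u) *
      ⟪cross (iteratedDeriv 1 c u) (iteratedDeriv 2 c u),
        cross (iteratedDeriv 1 c u) (iteratedDeriv 4 c u)⟫_ℝ) *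
      (⟪cross (iteratedDeriv 1 c u) (iteratedDeriv 2 c u),
        cross (iteratedDeriv 1 c u) (iteratedDeriv 2 c u)⟫_ℝ)⁻¹ :=
    (eq_mul_inv_iff_mul_eq₀ hn).2 (tripleProduct_mul_inner_cross _ _ _ _)
  linear_combination (norm := skip) (-2 * a u) * hrel
  simp only [tripleProduct_eq_coords, PiLp.add_apply, PiLp.smul_apply, smul_eq_mul]
  ring

end Curve

/-! ### Evolution under curve shortening flow -/

theorem periodic_iteratedDeriv {F : Type*} [NormedAddCommGroup F] [NormedSpace ℝ F] {f : ℝ → F}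
    {P : ℝ} (hf : Function.Periodic f P) (k : ℕ) : Function.Periodic (iteratedDeriv k f) P := by
  intro u
  rw [← congrFun (iteratedDeriv_comp_add_const k f P) u, funext hf]

theorem isTwisted_iff (c : ℝ → E3) : IsTwisted c ↔ ∀ u,
    tripleProduct (iteratedDeriv 1 c u) (iteratedDeriv 2 c u) (iteratedDeriv 3 c u) ≠ 0 :=
  forall_congr' fun _ => linearIndependent_iff_tripleProduct_ne_zero _

section Flow

variable {γ : ℝ → ℝ → E3} {ω t : ℝ}

theorem IsCurveShorteningFlow.hasDerivAt (hγ : IsCurveShorteningFlow γ ω) (ht : t ∈ Ioo 0 ω)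
    (u : ℝ) : HasDerivAt (fun s => γ s u)
      (secondOrderCoeff (γ t) u • iteratedDeriv 2 (γ t) u +
        firstOrderCoeff (γ t) u • iteratedDeriv 1 (γ t) u) t := by
  have ht' := Ioo_subset_Ico_self ht
  rw [← arcDeriv_unitTangent (contDiff_slice hγ.smooth ht') (hγ.immersed t ht' u),
    ← curvature_smul_unitNormal]
  exact (hγ.flow t ht' u).hasDerivAt (Ico_mem_nhds ht.1 ht.2)

theorem IsCurveShorteningFlow.contDiffOn_secondOrderCoeff (hγ : IsCurveShorteningFlow γ ω) :
    ContDiffOn ℝ ((⊤ : ℕ∞) : WithTop ℕ∞) (Function.uncurry fun s => secondOrderCoeff (γ s))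
      (Ico 0 ω ×ˢ univ) := by
  have h1 := contDiffOn_uncurry_iteratedDeriv hγ.smooth 1
  refine (h1.inner ℝ h1).inv fun x hx => inner_self_ne_zero.2 ?_
  simpa [Function.uncurry, iteratedDeriv_one] using hγ.immersed x.1 hx.1 x.2

theorem IsCurveShorteningFlow.contDiffOn_firstOrderCoeff (hγ : IsCurveShorteningFlow γ ω) :
    ContDiffOn ℝ ((⊤ : ℕ∞) : WithTop ℕ∞) (Function.uncurry fun s => firstOrderCoeff (γ s))
      (Ico 0 ω ×ˢ univ) :=
  ((contDiffOn_uncurry_iteratedDeriv hγ.smooth 1).inner ℝ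
    (contDiffOn_uncurry_iteratedDeriv hγ.smooth 2)).neg.mul (hγ.contDiffOn_secondOrderCoeff.pow 2)

end Flow

theorem proposition3 (γ : ℝ → ℝ → E3) (ω t₀ : ℝ) (ht₀ : t₀ ∈ Set.Ico 0 ω)
    (hγ : IsCurveShorteningFlow γ ω)
    (htwisted : IsTwisted (γ 0))
    (hinfl : ∀ t ∈ Set.Icc 0 t₀, ¬ HasInflectionPoint (γ t)) :
    ∀ t ∈ Set.Icc 0 t₀, IsTwisted (γ t) ∧ ∀ u, torsion (γ t) u ≠ 0 := by
  have hsub : Icc 0 t₀ ⊆ Ico 0 ω := Icc_subset_Ico_right ht₀.2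
  have hslab : Icc 0 t₀ ×ˢ (univ : Set ℝ) ⊆ Ico 0 ω ×ˢ univ := prod_mono_left hsub
  have hκ : ∀ t ∈ Icc 0 t₀, ∀ u, curvature (γ t) u ≠ 0 := fun t ht u h => hinfl t ht ⟨u, h⟩
  have hsmooth : ∀ t ∈ Icc 0 t₀, ContDiff ℝ ((⊤ : ℕ∞) : WithTop ℕ∞) (γ t) :=
    fun t ht => contDiff_slice hγ.smooth (hsub ht)
  have hcross : ∀ t ∈ Icc 0 t₀, ∀ u, _ := fun t ht u =>
    inner_cross_self_ne_zero (hsmooth t ht) (hγ.immersed t (hsub ht) u) (hκ t ht u)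
  have hC : ∀ k, ContinuousOn (Function.uncurry fun s => iteratedDeriv k (γ s))
      (Icc 0 t₀ ×ˢ univ) := fun k =>
    (contDiffOn_uncurry_iteratedDeriv hγ.smooth k).continuousOn.mono hslab
  have hdet : ∀ t ∈ Icc 0 t₀, ∀ u, tripleProduct (iteratedDeriv 1 (γ t) u)
      (iteratedDeriv 2 (γ t) u) (iteratedDeriv 3 (γ t) u) ≠ 0 := by
    refine parabolic_ne_zero
      (a := fun t => secondOrderCoeff (γ t))
      (p := fun t u => 3 * iteratedDeriv 1 (secondOrderCoeff (γ t)) u + firstOrderCoeff (γ t) u -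
        2 * secondOrderCoeff (γ t) u *
          ⟪cross (iteratedDeriv 1 (γ t) u) (iteratedDeriv 2 (γ t) u),
            cross (iteratedDeriv 1 (γ t) u) (iteratedDeriv 3 (γ t) u)⟫_ℝ *
          (⟪cross (iteratedDeriv 1 (γ t) u) (iteratedDeriv 2 (γ t) u),
            cross (iteratedDeriv 1 (γ t) u) (iteratedDeriv 2 (γ t) u)⟫_ℝ)⁻¹)
      (q := fun t u => 4 * iteratedDeriv 2 (secondOrderCoeff (γ t)) u +
        6 * iteratedDeriv 1 (firstOrderCoeff (γ t)) u +
        2 * secondOrderCoeff (γ t) u *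
          ⟪cross (iteratedDeriv 1 (γ t) u) (iteratedDeriv 2 (γ t) u),
            cross (iteratedDeriv 1 (γ t) u) (iteratedDeriv 4 (γ t) u)⟫_ℝ *
          (⟪cross (iteratedDeriv 1 (γ t) u) (iteratedDeriv 2 (γ t) u),
            cross (iteratedDeriv 1 (γ t) u) (iteratedDeriv 2 (γ t) u)⟫_ℝ)⁻¹)
      Real.two_pi_pos ?_ ?_ ?_ ?_ ?_ ((isTwisted_iff _).1 htwisted)
    · have hcoord : ∀ k i, ContinuousOn (fun x : ℝ × ℝ => iteratedDeriv k (γ x.1) x.2 i)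
          (Icc 0 t₀ ×ˢ univ) := fun k i =>
        (EuclideanSpace.proj (𝕜 := ℝ) i).continuous.comp_continuousOn (hC k)
      simp only [Function.uncurry_def, tripleProduct_eq_coords]
      fun_prop
    · have hinner : ∀ j k, ContinuousOn (fun x : ℝ × ℝ =>
          ⟪iteratedDeriv j (γ x.1) x.2, iteratedDeriv k (γ x.1) x.2⟫_ℝ) (Icc 0 t₀ ×ˢ univ) :=
        fun j k => (hC j).inner (hC k)
      have ha : ∀ k, ContinuousOn (fun x : ℝ × ℝ => iteratedDeriv k (secondOrderCoeff (γ x.1)) x.2)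
          (Icc 0 t₀ ×ˢ univ) := fun k => (contDiffOn_uncurry_iteratedDeriv
            hγ.contDiffOn_secondOrderCoeff k).continuousOn.mono hslab
      have hb : ∀ k, ContinuousOn (fun x : ℝ × ℝ => iteratedDeriv k (firstOrderCoeff (γ x.1)) x.2)
          (Icc 0 t₀ ×ˢ univ) := fun k => (contDiffOn_uncurry_iteratedDeriv
            hγ.contDiffOn_firstOrderCoeff k).continuousOn.mono hslab
      have hg : ∀ k l, ContinuousOn (fun x : ℝ × ℝ =>
          ⟪cross (iteratedDeriv 1 (γ x.1) x.2) (iteratedDeriv 2 (γ x.1) x.2),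
            cross (iteratedDeriv k (γ x.1) x.2) (iteratedDeriv l (γ x.1) x.2)⟫_ℝ)
          (Icc 0 t₀ ×ˢ univ) := fun k l => by
        simp only [inner_cross_cross]
        exact ((hinner 1 k).mul (hinner 2 l)).sub ((hinner 1 l).mul (hinner 2 k))
      have ha0 := ha 0
      simp only [iteratedDeriv_zero] at ha0
      exact ((continuousOn_const.mul (ha 2)).add (continuousOn_const.mul (hb 1))).add
        (((continuousOn_const.mul ha0).mul (hg 1 4)).mul
          ((hg 1 2).inv₀ fun x hx => hcross x.1 hx.1 x.2))
    · intro t ht u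
      have hper := periodic_iteratedDeriv (hγ.closed t (hsub ht))
      simp only [hper 1 u, hper 2 u, hper 3 u]
    · intro t ht u
      exact inv_nonneg.2 real_inner_self_nonneg
    · intro t ht u
      have ht' : t ∈ Icc 0 t₀ := Ioc_subset_Icc_self ht
      have hto : t ∈ Ioo 0 ω := ⟨ht.1, (hsub ht').2⟩
      have hX := hasDerivAt_iteratedDeriv_of_hasDerivAt hγ.smooth hto (hγ.hasDerivAt hto)
      rw [← tripleProduct_variation (hsmooth t ht')
        (contDiff_slice hγ.contDiffOn_secondOrderCoeff (hsub ht'))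
        (contDiff_slice hγ.contDiffOn_firstOrderCoeff (hsub ht')) rfl rfl (hcross t ht' u)]
      exact (hX 1 u).tripleProduct (hX 2 u) (hX 3 u)
  exact fun t ht => ⟨(isTwisted_iff _).2 (hdet t ht), fun u =>
    torsion_ne_zero (hsmooth t ht) (hγ.immersed t (hsub ht)) (hκ t ht u) (hdet t ht u)⟩
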